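/- A (real) Banach lattice $X$ has a *strictly monotone* norm if $0\le x\le y$ and $x\ne y$ imply $\|x\|<\|y\|$. For $1<r<\infty$ and $x,y\in X$, put $$(|x|^r+|y|^r)^{1/r}=\sup\{a|x|+b|y| : a,b\ge 0,\ a^{r'}+b^{r'}\le 1\},\qquad r'=\tfrac{r}{r-1}$$ (this supremum always exists in $X$). $X$ is *exactly $r$-convex* if it is $r$-convex with constant one, i.e. $\|(|x|^r+|y|^r)^{1/r}\|\le(\|x\|^r+\|y\|^r)^{1/r}$ for all $x,y\in X$. A complex Banach lattice is the complexification $X_{\mathbb C}=X+iX$ of a real Banach lattice $X$, with modulus $|a+ib|=\sup_\theta\,\big((\cos\theta)a+(\sin\theta)b\big)\in X$ and norm $\|z\|=\|\,|z|\,\|$; it is called exactly $r$-convex, or strictly monotone, if $X$ is. Elements $x,y$ of a real or complex Banach lattice are *disjoint* if $|x|\wedge|y|=0$. Proposition. Let $r>2$ be a real number. (1) Let $X$ be a strictly monotone, exactly $r$-convex (real or complex) Banach lattice. Then two elements $x,y\in X$ are disjoint if and only if $$\|x+ty\|^r+\|x-ty\|^r\le 2\big(\|x\|^r+t^r\|y\|^r\big)\quad\text{for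 all } t\in[0,1].$$ (2) Consequently, let $X$ and $Y$ be exactly $r$-convex Banach lattices, both real or both complex, and assume that $Y$ has a strictly monotone norm. Then every (not necessarily surjective) linear isometry $T:X\to Y$ preserves disjointness: if $x,y\in X$ are disjoint, so are $Tx,Ty$. -/

import Mathlib

namespace BanachLattice

/-- The least upper bound of a set, where it exists (and `0` otherwise). -/
noncomputable def lub {X : Type*} [Lattice X] [Zero X] (S : Set X) : X :=
  open Classical in if h : ∃ z, IsLUB S z then h.choose else 0

theorem isLUB_lub {X : Type*} [Lattice X] [Zero X] {S : Set X} (h : ∃ z, IsLUB S z) :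
    IsLUB S (lub S) := by
  unfold lub
  rw [dif_pos h]
  exact h.choose_spec

section

variable {X : Type*} [NormedAddCommGroup X] [Lattice X] [IsOrderedAddMonoid X]
  [HasSolidNorm X] [NormedSpace ℝ X] [IsOrderedModule ℝ X]

/-- In a Banach lattice, a family of linear combinations of two fixed vectors, with coefficients in
a compact set, has a least upper bound. -/
theorem exists_isLUB_image [CompleteSpace X] {K : Set (ℝ × ℝ)} (hK : IsCompact K)
    (hne : K.Nonempty) (p q : X) :
    ∃ z, IsLUB ((fun c : ℝ × ℝ => c.1 • p + c.2 • q) '' K) z := by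
  classical
  set e : X := |p| + |q| with he
  have he0 : 0 ≤ e := add_nonneg (abs_nonneg _) (abs_nonneg _)
  set L : ℝ × ℝ → X := fun c => c.1 • p + c.2 • q with hL
  have hsm : ∀ (t ε : ℝ) (v : X), |t| ≤ ε → t • v ≤ ε • |v| := by
    intro t ε v ht
    have h2 : t • v ≤ |t| • |v| := by
      rcases le_total 0 t with h | h
      · rw [abs_of_nonneg h]
        exact smul_le_smul_of_nonneg_left (le_abs_self v) h
      · rw [abs_of_nonpos h]
        have := smul_le_smul_of_nonneg_left (neg_le_abs v) (neg_nonneg.mpr h)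
        simpa using this
    exact h2.trans (smul_le_smul_of_nonneg_right ht (abs_nonneg v))
  have hnet : ∀ n : ℕ, ∃ F : Finset X, F.Nonempty ∧ (∀ f ∈ F, f ∈ L '' K) ∧
      ∀ s ∈ L '' K, ∃ f ∈ F, s ≤ f + ((1 / 2 : ℝ) ^ n) • e := by
    intro n
    obtain ⟨T, hTK, hTf, hcov⟩ := hK.finite_cover_balls (e := (1 / 2 : ℝ) ^ n) (by positivity)
    refine ⟨hTf.toFinset.image L, ?_, ?_, ?_⟩
    · obtain ⟨c, hc⟩ := hne
      obtain ⟨d, hd, -⟩ := Set.mem_iUnion₂.mp (hcov hc)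
      exact ⟨L d, Finset.mem_image_of_mem _ (by simpa using hd)⟩
    · intro f hf
      obtain ⟨d, hd, rfl⟩ := Finset.mem_image.mp hf
      exact ⟨d, hTK (by simpa using hd), rfl⟩
    · rintro _ ⟨c, hc, rfl⟩
      obtain ⟨d, hd, hcd⟩ := Set.mem_iUnion₂.mp (hcov hc)
      refine ⟨L d, Finset.mem_image_of_mem _ (by simpa using hd), ?_⟩
      rw [Metric.mem_ball, Prod.dist_eq, max_lt_iff, Real.dist_eq, Real.dist_eq] at hcd
      have h1 := hsm _ _ p hcd.1.le
      have h2 := hsm _ _ q hcd.2.le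
      have h3 := add_le_add h1 h2
      rw [← smul_add, ← he] at h3
      have h4 : L c = L d + ((c.1 - d.1) • p + (c.2 - d.2) • q) := by
        simp only [hL, sub_smul]; abel
      rw [h4]
      exact add_le_add_right h3 _
  choose F hFne hFS hFnet using hnet
  set u : ℕ → X := fun n => (F n).sup' (hFne n) id with hu
  have hub : ∀ n, ∀ s ∈ L '' K, s ≤ u n + ((1 / 2 : ℝ) ^ n) • e := by
    intro n s hs
    obtain ⟨f, hf, hsf⟩ := hFnet n s hs
    exact hsf.trans (add_le_add_left (Finset.le_sup' id hf) _)
  have huu : ∀ m n, u m - u n ≤ ((1 / 2 : ℝ) ^ n) • e := by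
    intro m n
    rw [sub_le_iff_le_add']
    exact Finset.sup'_le _ _ fun f hf => hub n f (hFS m f hf)
  have hdist : ∀ n, dist (u n) (u (n + 1)) ≤ ‖e‖ * (1 / 2 : ℝ) ^ n := by
    intro n
    rw [dist_eq_norm]
    have h1 : |u n - u (n + 1)| ≤ |((1 / 2 : ℝ) ^ n) • e| := by
      refine le_trans ?_ (le_abs_self _)
      rw [abs_le']
      refine ⟨(huu n (n + 1)).trans (smul_le_smul_of_nonneg_right ?_ he0), ?_⟩
      · exact pow_le_pow_of_le_one (by norm_num) (by norm_num) (Nat.le_succ n)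
      · rw [neg_sub]
        exact huu (n + 1) n
    have h2 := norm_le_norm_of_abs_le_abs h1
    rw [norm_smul, Real.norm_of_nonneg (by positivity), mul_comm] at h2
    exact h2
  obtain ⟨z, hz⟩ := cauchySeq_tendsto_of_complete
    (cauchySeq_of_le_geometric (1 / 2) ‖e‖ (by norm_num) hdist)
  refine ⟨z, ?_, ?_⟩
  · intro s hs
    have hlim : Filter.Tendsto (fun n => u n + ((1 / 2 : ℝ) ^ n) • e) Filter.atTop (nhds z) := by
      have := hz.add ((tendsto_pow_atTop_nhds_zero_of_lt_one (r := (1 / 2 : ℝ)) (by norm_num)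
        (by norm_num)).smul_const e)
      simpa using this
    exact ge_of_tendsto' hlim fun n => hub n s hs
  · intro b hb
    exact le_of_tendsto' hz fun n => Finset.sup'_le _ _ fun f hf => hb (hFS n f hf)

/-- The element `(|x| ^ r + |y| ^ r) ^ (1 / r)` of a Banach lattice, for `1 < r < ∞`: the least
upper bound of all `a • |x| + b • |y|` with `a, b ≥ 0` and `a ^ r' + b ^ r' ≤ 1`, where
`r' = r / (r - 1)`. -/
noncomputable def lrSum (r : ℝ) (x y : X) : X :=
  lub {z | ∃ a b : ℝ, 0 ≤ a ∧ 0 ≤ b ∧ a ^ (r / (r - 1)) + b ^ (r / (r - 1)) ≤ 1 ∧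
    z = a • |x| + b • |y|}

/-- The least upper bound in the definition of `lrSum` exists. -/
theorem isLUB_lrSum [CompleteSpace X] {r : ℝ} (hr : 1 < r) (x y : X) :
    IsLUB {z | ∃ a b : ℝ, 0 ≤ a ∧ 0 ≤ b ∧ a ^ (r / (r - 1)) + b ^ (r / (r - 1)) ≤ 1 ∧
      z = a • |x| + b • |y|} (lrSum r x y) := by
  refine isLUB_lub ?_
  set q : ℝ := r / (r - 1)
  have hq : 0 < q := div_pos (by linarith) (by linarith)
  set K : Set (ℝ × ℝ) := {c | 0 ≤ c.1 ∧ 0 ≤ c.2 ∧ c.1 ^ q + c.2 ^ q ≤ 1} with hKdef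
  have hclosed : IsClosed K := by
    have hcont : Continuous fun c : ℝ × ℝ => c.1 ^ q + c.2 ^ q :=
      (continuous_fst.rpow_const fun _ => Or.inr hq.le).add
        (continuous_snd.rpow_const fun _ => Or.inr hq.le)
    exact (isClosed_le continuous_const continuous_fst).inter
      ((isClosed_le continuous_const continuous_snd).inter (isClosed_le hcont continuous_const))
  have hone : ∀ a : ℝ, 0 ≤ a → a ^ q ≤ 1 → a ≤ 1 := by
    intro a ha h
    by_contra! hlt
    exact absurd h (not_le.mpr (Real.one_lt_rpow hlt hq))
  have hbox : K ⊆ Set.Icc 0 1 ×ˢ Set.Icc 0 1 := by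
    rintro ⟨a, b⟩ ⟨ha, hb, hab⟩
    simp only at ha hb hab
    have h1 : a ^ q ≤ 1 := by linarith [Real.rpow_nonneg hb q]
    have h2 : b ^ q ≤ 1 := by linarith [Real.rpow_nonneg ha q]
    exact ⟨⟨ha, hone a ha h1⟩,
      ⟨hb, hone b hb h2⟩⟩
  have hcompact : IsCompact K := (isCompact_Icc.prod isCompact_Icc).of_isClosed_subset hclosed hbox
  have hne : K.Nonempty := ⟨(0, 0), le_rfl, le_rfl, by simp [Real.zero_rpow hq.ne']⟩
  obtain ⟨z, hz⟩ := exists_isLUB_image hcompact hne |x| |y|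
  refine ⟨z, ?_⟩
  convert hz using 1
  ext w
  constructor
  · rintro ⟨a, b, ha, hb, hab, rfl⟩
    exact ⟨(a, b), ⟨ha, hb, hab⟩, rfl⟩
  · rintro ⟨⟨a, b⟩, ⟨ha, hb, hab⟩, rfl⟩
    exact ⟨a, b, ha, hb, hab, rfl⟩

end

/-- A Banach lattice is exactly `r`-convex if it is `r`-convex with constant one. -/
def IsExactlyConvex (r : ℝ) (X : Type*) [NormedAddCommGroup X] [Lattice X] [NormedSpace ℝ X] :
    Prop :=
  ∀ x y : X, ‖lrSum r x y‖ ≤ (‖x‖ ^ r + ‖y‖ ^ r) ^ (1 / r)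

/-- The norm of a normed lattice is strictly monotone. -/
def IsStrictlyMonotone (X : Type*) [NormedAddCommGroup X] [Lattice X] : Prop :=
  ∀ x y : X, 0 ≤ x → x < y → ‖x‖ < ‖y‖

/-- The complexification `X + iX` of a real vector space `X`; the pair `(a, b)` is `a + ib`. -/
def Complexification (X : Type*) : Type _ := X × X

namespace Complexification

instance {X : Type*} [AddCommGroup X] : AddCommGroup (Complexification X) :=
  inferInstanceAs (AddCommGroup (X × X))

instance {X : Type*} [AddCommGroup X] [Module ℝ X] : Module ℂ (Complexification X) where
  smul c z := (c.re • z.1 - c.im • z.2, c.re • z.2 + c.im • z.1)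
  one_smul z := by
    refine Prod.ext ?_ ?_
    · change (1 : ℂ).re • z.1 - (1 : ℂ).im • z.2 = z.1
      simp
    · change (1 : ℂ).re • z.2 + (1 : ℂ).im • z.1 = z.2
      simp
  mul_smul c d z := by
    refine Prod.ext ?_ ?_
    · change (c * d).re • z.1 - (c * d).im • z.2 = c.re • (d.re • z.1 - d.im • z.2)
        - c.im • (d.re • z.2 + d.im • z.1)
      rw [Complex.mul_re, Complex.mul_im]
      module
    · change (c * d).re • z.2 + (c * d).im • z.1 = c.re • (d.re • z.2 + d.im • z.1)
        + c.im • (d.re • z.1 - d.im • z.2)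
      rw [Complex.mul_re, Complex.mul_im]
      module
  smul_zero c := by
    refine Prod.ext ?_ ?_
    · change c.re • (0 : X) - c.im • (0 : X) = 0
      simp
    · change c.re • (0 : X) + c.im • (0 : X) = 0
      simp
  smul_add c z w := by
    refine Prod.ext ?_ ?_
    · change c.re • (z.1 + w.1) - c.im • (z.2 + w.2) = (c.re • z.1 - c.im • z.2)
        + (c.re • w.1 - c.im • w.2)
      module
    · change c.re • (z.2 + w.2) + c.im • (z.1 + w.1) = (c.re • z.2 + c.im • z.1)
        + (c.re • w.2 + c.im • w.1)
      module
  add_smul c d z := by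
    refine Prod.ext ?_ ?_
    · change (c + d).re • z.1 - (c + d).im • z.2 = (c.re • z.1 - c.im • z.2)
        + (d.re • z.1 - d.im • z.2)
      rw [Complex.add_re, Complex.add_im]
      module
    · change (c + d).re • z.2 + (c + d).im • z.1 = (c.re • z.2 + c.im • z.1)
        + (d.re • z.2 + d.im • z.1)
      rw [Complex.add_re, Complex.add_im]
      module
  zero_smul z := by
    refine Prod.ext ?_ ?_
    · change (0 : ℂ).re • z.1 - (0 : ℂ).im • z.2 = 0
      simp
    · change (0 : ℂ).re • z.2 + (0 : ℂ).im • z.1 = 0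
      simp

variable {X : Type*} [NormedAddCommGroup X] [Lattice X] [NormedSpace ℝ X]

/-- The modulus `|a + ib|`, the least upper bound of all `(cos θ) a + (sin θ) b`. -/
noncomputable def modulus (z : Complexification X) : X :=
  lub (Set.range fun θ : ℝ => Real.cos θ • z.1 + Real.sin θ • z.2)

/-- The least upper bound in the definition of the modulus exists. -/
theorem isLUB_modulus [IsOrderedAddMonoid X] [HasSolidNorm X] [IsOrderedModule ℝ X]
    [CompleteSpace X] (z : Complexification X) :
    IsLUB (Set.range fun θ : ℝ => Real.cos θ • z.1 + Real.sin θ • z.2) z.modulus := by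
  refine isLUB_lub ?_
  have hper : Function.Periodic (fun θ : ℝ => (Real.cos θ, Real.sin θ)) (2 * Real.pi) := by
    intro θ
    simp
  have hK : IsCompact (Set.range fun θ : ℝ => (Real.cos θ, Real.sin θ)) := by
    rw [← hper.image_Icc (by positivity) 0]
    exact isCompact_Icc.image (Real.continuous_cos.prodMk Real.continuous_sin)
  obtain ⟨w, hw⟩ := exists_isLUB_image hK (Set.range_nonempty _) z.1 z.2
  refine ⟨w, ?_⟩
  rwa [← Set.range_comp] at hw

/-- The norm of the complexification of a Banach lattice: `‖z‖ = ‖ |z| ‖`. -/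
noncomputable instance : Norm (Complexification X) := ⟨fun z => ‖z.modulus‖⟩

end Complexification

end BanachLattice

namespace BanachLattice

/-! If x and y are disjoint, then |x| + t|y| = |x| ∨ t|y| lies below (|x|^r + |ty|^r)^(1/r), and
exact convexity bounds both ‖x ± ty‖^r by ‖x‖^r + t^r‖y‖^r.

Conversely, let a = |x|, b = |y| and suppose a ∧ b ≠ 0. For r ≥ 2 the scalar inequality 2^(1/r)
(|x|² + |y|²)^(1/2) ≤ (|x + y|^r + |x - y|^r)^(1/r) survives in the lattice
(`smul_modulus_add_le_lrSum`). Applied to x and ty, together with exact convexity and the assumed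
estimate, it yields ‖a + t²v‖^r ≤ ‖a‖^r + t^r‖b‖^r for some fixed v with 0 ≠ v and 0 ≤ v ≤ a. Strict
monotonicity and convexity of the norm give ‖a + t²v‖ ≥ ‖a‖ + t²δ with δ > 0, which fails for small
t because r > 2 (`exists_add_mul_sq_rpow_gt`).

The real case embeds in the complex one. The criterion involves only norms, so linear isometries
transport it. -/

theorem norm_le_norm_of_nonneg_of_le {X : Type*} [NormedAddCommGroup X] [Lattice X]
    [IsOrderedAddMonoid X] [HasSolidNorm X] {a b : X} (ha : 0 ≤ a) (hab : a ≤ b) : ‖a‖ ≤ ‖b‖ :=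
  norm_le_norm_of_abs_le_abs (by rwa [abs_of_nonneg ha, abs_of_nonneg (ha.trans hab)])

theorem add_eq_sup_of_inf_eq_zero {X : Type*} [AddCommGroup X] [Lattice X]
    [IsOrderedAddMonoid X] {a b : X} (h : a ⊓ b = 0) : a + b = a ⊔ b := by
  rw [← inf_add_sup a b, h, zero_add]

theorem inf_smul_eq_zero {X : Type*} [AddCommGroup X] [Lattice X] [IsOrderedAddMonoid X]
    [Module ℝ X] [IsOrderedModule ℝ X] {a b : X} (ha : 0 ≤ a) (hb : 0 ≤ b) (h : a ⊓ b = 0)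
    {t : ℝ} (ht0 : 0 ≤ t) (ht1 : t ≤ 1) : a ⊓ t • b = 0 := by
  refine le_antisymm ?_ (le_inf ha (smul_nonneg ht0 hb))
  rw [← h]
  refine inf_le_inf le_rfl ?_
  simpa using smul_le_smul_of_nonneg_right ht1 hb

theorem IsExactlyConvex.norm_lrSum_rpow_le {X : Type*} [NormedAddCommGroup X]
    [Lattice X] [NormedSpace ℝ X] {r : ℝ} (hr : 1 < r)
    (h : IsExactlyConvex r X)
    (x y : X) : ‖lrSum r x y‖ ^ r ≤ ‖x‖ ^ r + ‖y‖ ^ r := by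
  have h0 : 0 ≤ ‖x‖ ^ r + ‖y‖ ^ r := by positivity
  calc ‖lrSum r x y‖ ^ r ≤ ((‖x‖ ^ r + ‖y‖ ^ r) ^ (1 / r)) ^ r :=
        Real.rpow_le_rpow (norm_nonneg _) (h x y) (by linarith)
    _ = ‖x‖ ^ r + ‖y‖ ^ r := by
        rw [← Real.rpow_mul h0, one_div, inv_mul_cancel₀ (by linarith), Real.rpow_one]

/-- Convexity of the norm along the ray from `a - v` through `a`. -/
theorem norm_add_mul_le_norm_add_smul {E : Type*} [NormedAddCommGroup E] [NormedSpace ℝ E] (a v : E)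
    {s : ℝ} (hs : 0 ≤ s) :
    ‖a‖ + s * (‖a‖ - ‖a - v‖) ≤ ‖a + s • v‖ := by
  -- Up to the factor 1 + s, a is a convex combination of a + sv and a - v.
  have h1 : (1 + s) • a = (a + s • v) + s • (a - v) := by module
  have h2 := norm_add_le (a + s • v) (s • (a - v))
  rw [← h1, norm_smul, norm_smul, Real.norm_of_nonneg hs, Real.norm_of_nonneg (by linarith)] at h2
  linarith

/-! ### Upper estimates for positive elements -/

section Lattice

variable {X : Type*} [NormedAddCommGroup X] [Lattice X] [IsOrderedAddMonoid X]
  [HasSolidNorm X] [NormedSpace ℝ X] [IsOrderedModule ℝ X]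

theorem smul_add_smul_le_lrSum [CompleteSpace X] {r : ℝ} (hr : 1 < r) {x y : X} (hx : 0 ≤ x)
    (hy : 0 ≤ y) {a b : ℝ} (ha : 0 ≤ a) (hb : 0 ≤ b)
    (hab : a ^ (r / (r - 1)) + b ^ (r / (r - 1)) ≤ 1) : a • x + b • y ≤ lrSum r x y :=
  (isLUB_lrSum hr x y).1 ⟨a, b, ha, hb, hab, by rw [abs_of_nonneg hx, abs_of_nonneg hy]⟩

theorem sup_le_lrSum [CompleteSpace X] {r : ℝ} (hr : 1 < r) {x y : X} (hx : 0 ≤ x)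
    (hy : 0 ≤ y) : x ⊔ y ≤ lrSum r x y := by
  have hq : r / (r - 1) ≠ 0 := (div_pos (by linarith) (by linarith)).ne'
  refine sup_le ?_ ?_
  · simpa using smul_add_smul_le_lrSum hr hx hy (a := 1) (b := 0) zero_le_one le_rfl
      (by simp [Real.zero_rpow hq])
  · simpa using smul_add_smul_le_lrSum hr hx hy (a := 0) (b := 1) le_rfl zero_le_one
      (by simp [Real.zero_rpow hq])

/-- Disjoint positive elements have their supremum as sum, and the supremum lies below `lrSum`. -/
theorem IsExactlyConvex.norm_add_rpow_le [CompleteSpace X] {r : ℝ} (hr : 1 < r)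
    (h : IsExactlyConvex r X) {x y : X} (hx : 0 ≤ x) (hy : 0 ≤ y) (hxy : x ⊓ y = 0) :
    ‖x + y‖ ^ r ≤ ‖x‖ ^ r + ‖y‖ ^ r := by
  refine le_trans ?_ (h.norm_lrSum_rpow_le hr x y)
  refine Real.rpow_le_rpow (norm_nonneg _) ?_ (by linarith)
  refine norm_le_norm_of_nonneg_of_le (add_nonneg hx hy) ?_
  rw [add_eq_sup_of_inf_eq_zero hxy]
  exact sup_le_lrSum hr hx hy

/-- If `κ u - κ² a` has zero positive part for all small `κ > 0`, then `u = 0`. -/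
theorem exists_posPart_ne_zero {a u : X} (hu : 0 ≤ u) (hne : u ≠ 0) :
    ∃ κ : ℝ, 0 < κ ∧ κ ≤ 1 ∧ (κ • u - κ ^ 2 • a) ⊔ 0 ≠ 0 := by
  by_contra! hcon
  have hle : ∀ κ : ℝ, 0 < κ → κ ≤ 1 → ‖u‖ ≤ κ * ‖a‖ := by
    intro κ h0 h1
    have h2 : κ • u - κ ^ 2 • a ≤ 0 := by
      rw [← hcon κ h0 h1]
      exact le_sup_left
    have h3 : κ • u ≤ κ • κ • a := by
      rw [smul_smul, ← pow_two]
      exact sub_nonpos.mp h2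
    have h4 : u ≤ κ • a := by
      have := smul_le_smul_of_nonneg_left h3 (inv_nonneg.mpr h0.le)
      rwa [inv_smul_smul₀ h0.ne', inv_smul_smul₀ h0.ne'] at this
    have h5 := norm_le_norm_of_nonneg_of_le hu h4
    rwa [norm_smul, Real.norm_of_nonneg h0.le] at h5
  have hpos : 0 < ‖u‖ := norm_pos_iff.mpr hne
  have hden : 0 < 2 * (‖a‖ + ‖u‖) := by positivity
  -- This κ makes κ‖a‖ smaller than ‖u‖ / 2.
  have h := hle (‖u‖ / (2 * (‖a‖ + ‖u‖))) (by positivity)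
    ((div_le_one hden).mpr (by linarith [norm_nonneg a]))
  rw [div_mul_eq_mul_div, le_div_iff₀ hden] at h
  nlinarith [norm_nonneg a]

end Lattice

/-- An `r`-th power cannot grow by a quadratic term when `r > 2` bounds its growth by `t ^ r`. -/
theorem exists_add_mul_sq_rpow_gt {r A B δ : ℝ} (hr : 2 < r) (hA : 0 < A)
    (hδ : 0 < δ) : ∃ t ∈ Set.Icc (0 : ℝ) 1, A ^ r + t ^ r * B ^ r < (A + t ^ 2 * δ) ^ r := by
  -- By Bernoulli's inequality, (A + t²δ)^r exceeds A^r by at least c t²; it remains to make t^(r-2)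
  -- B^r smaller than c.
  set c : ℝ := A ^ r * (r * (δ / A)) with hc
  have hcpos : 0 < c := by positivity
  have hlim : Filter.Tendsto (fun t : ℝ => t ^ (r - 2) * B ^ r) (nhdsWithin 0 (Set.Ioi 0))
      (nhds 0) := by
    have h : ContinuousAt (fun t : ℝ => t ^ (r - 2) * B ^ r) 0 :=
      (Real.continuousAt_rpow_const _ _ (Or.inr (by linarith))).mul continuousAt_const
    have h2 := h.tendsto
    simp only [Real.zero_rpow (by linarith : r - 2 ≠ 0), zero_mul] at h2
    exact h2.mono_left nhdsWithin_le_nhds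
  have hev : ∀ᶠ t : ℝ in nhdsWithin 0 (Set.Ioi 0), t ∈ Set.Ioc (0 : ℝ) 1 :=
    Ioc_mem_nhdsGT one_pos
  obtain ⟨t, ht, ht0, ht1⟩ := ((hlim.eventually_lt_const hcpos).and hev).exists
  refine ⟨t, ⟨ht0.le, ht1⟩, ?_⟩
  have h1 : t ^ r = t ^ 2 * t ^ (r - 2) := by
    rw [← Real.rpow_natCast t 2, ← Real.rpow_add ht0]
    norm_num
  have h2 : A + t ^ 2 * δ = A * (1 + t ^ 2 * (δ / A)) := by
    field_simp
  have hnn : 0 ≤ t ^ 2 * (δ / A) := by positivity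
  have h3 : 1 + r * (t ^ 2 * (δ / A)) ≤ (1 + t ^ 2 * (δ / A)) ^ r :=
    one_add_mul_self_le_rpow_one_add (by linarith) (by linarith)
  rw [h2, Real.mul_rpow hA.le (by linarith), h1]
  have h4 := mul_le_mul_of_nonneg_left h3 (Real.rpow_nonneg hA.le r)
  have h5 : t ^ 2 * (t ^ (r - 2) * B ^ r) < t ^ 2 * c :=
    mul_lt_mul_of_pos_left ht (by positivity)
  have h6 : A ^ r * (1 + r * (t ^ 2 * (δ / A))) = A ^ r + t ^ 2 * c := by
    rw [hc]; ring
  linarith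

/-- Comparison of power means: exponents `q ≤ 2` and `2`. -/
theorem rpow_add_rpow_le_of_sq_add_sq_le {q a b s : ℝ} (hq : 0 < q) (hq2 : q ≤ 2) (ha : 0 ≤ a)
    (hb : 0 ≤ b) (hs : 0 ≤ s) (h : a ^ 2 + b ^ 2 ≤ 2 * s ^ 2) : a ^ q + b ^ q ≤ 2 * s ^ q := by
  have hpow : ∀ c : ℝ, 0 ≤ c → c ^ q = (c ^ 2) ^ (q / 2) := by
    intro c hc
    rw [← Real.rpow_natCast c 2, ← Real.rpow_mul hc]
    congr 1
    push_cast
    ring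
  have hconc := (Real.concaveOn_rpow (p := q / 2) (by linarith) (by linarith)).2
    (Set.mem_Ici.mpr (sq_nonneg a)) (Set.mem_Ici.mpr (sq_nonneg b))
    (by norm_num : (0 : ℝ) ≤ 1 / 2) (by norm_num : (0 : ℝ) ≤ 1 / 2) (by norm_num)
  simp only [smul_eq_mul] at hconc
  have hmono : (1 / 2 * a ^ 2 + 1 / 2 * b ^ 2) ^ (q / 2) ≤ (s ^ 2) ^ (q / 2) :=
    Real.rpow_le_rpow (by positivity) (by linarith) (by linarith)
  rw [hpow a ha, hpow b hb, hpow s hs]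
  linarith

/-! ### The modulus on the complexification, and the criterion for complex lattices -/

namespace Complexification

section Algebra

variable {X : Type*} [AddCommGroup X]

theorem add_fst (x y : Complexification X) : (x + y).1 = x.1 + y.1 := rfl
theorem add_snd (x y : Complexification X) : (x + y).2 = x.2 + y.2 := rfl
theorem sub_fst (x y : Complexification X) : (x - y).1 = x.1 - y.1 := rfl
theorem sub_snd (x y : Complexification X) : (x - y).2 = x.2 - y.2 := rfl

theorem ofReal_smul_fst [Module ℝ X] (t : ℝ) (y : Complexification X) : ((t : ℂ) • y).1 = t • y.1 := by
  change (t : ℂ).re • y.1 - (t : ℂ).im • y.2 = _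
  simp

theorem ofReal_smul_snd [Module ℝ X] (t : ℝ) (y : Complexification X) : ((t : ℂ) • y).2 = t • y.2 := by
  change (t : ℂ).re • y.2 + (t : ℂ).im • y.1 = _
  simp

theorem sub_ofReal_smul [Module ℝ X] (x y : Complexification X) (t : ℝ) :
    x - (t : ℂ) • y = x + ((-t : ℝ) : ℂ) • y := by
  rw [Complex.ofReal_neg, neg_smul, sub_eq_add_neg]

/-- The inclusion of a real vector space in its complexification. -/
def ofVector (x : X) : Complexification X := (x, 0)

theorem ofVector_add_smul [Module ℝ X] (x y : X) (t : ℝ) :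
    ofVector x + (t : ℂ) • ofVector y = ofVector (x + t • y) := by
  refine Prod.ext ?_ ?_
  · rw [add_fst, ofReal_smul_fst]; rfl
  · rw [add_snd, ofReal_smul_snd]; simp [ofVector]

theorem ofVector_sub_smul [Module ℝ X] (x y : X) (t : ℝ) :
    ofVector x - (t : ℂ) • ofVector y = ofVector (x - t • y) := by
  rw [sub_ofReal_smul, ofVector_add_smul, neg_smul, sub_eq_add_neg]

end Algebra

theorem norm_def {X : Type*} [NormedAddCommGroup X] [Lattice X] [NormedSpace ℝ X]
    (z : Complexification X) : ‖z‖ = ‖z.modulus‖ := rfl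

variable {X : Type*} [NormedAddCommGroup X] [Lattice X] [IsOrderedAddMonoid X]
  [HasSolidNorm X] [NormedSpace ℝ X] [IsOrderedModule ℝ X] [CompleteSpace X]

theorem modulus_nonneg (z : Complexification X) : 0 ≤ z.modulus := by
  have h1 := (isLUB_modulus z).1 ⟨0, rfl⟩
  have h2 := (isLUB_modulus z).1 ⟨Real.pi, rfl⟩
  simp only [Real.cos_zero, Real.sin_zero, Real.cos_pi, Real.sin_pi, one_smul, zero_smul,
    add_zero, neg_smul] at h1 h2
  exact (abs_nonneg z.1).trans (abs_le'.mpr ⟨h1, h2⟩)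

theorem modulus_le_iff {z : Complexification X} {m : X} :
    z.modulus ≤ m ↔ ∀ θ : ℝ, Real.cos θ • z.1 + Real.sin θ • z.2 ≤ m := by
  rw [isLUB_le_iff (isLUB_modulus z)]
  simp [upperBounds]

theorem cos_smul_add_sin_smul_le (z : Complexification X) (θ : ℝ) :
    Real.cos θ • z.1 + Real.sin θ • z.2 ≤ z.modulus :=
  modulus_le_iff.mp le_rfl θ

/-- The polar form of w extends the defining bound from the unit circle to all complex coefficients.
-/
theorem re_smul_add_im_smul_le (z : Complexification X) (w : ℂ) :
    w.re • z.1 + w.im • z.2 ≤ ‖w‖ • z.modulus := by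
  have h := smul_le_smul_of_nonneg_left (cos_smul_add_sin_smul_le z w.arg) (norm_nonneg w)
  rwa [smul_add, smul_smul, smul_smul, Complex.norm_mul_cos_arg, Complex.norm_mul_sin_arg] at h

theorem modulus_add_smul_le (x y : Complexification X) (t : ℝ) :
    (x + (t : ℂ) • y).modulus ≤ x.modulus + |t| • y.modulus := by
  refine modulus_le_iff.mpr fun θ => ?_
  rw [add_fst, add_snd, ofReal_smul_fst, ofReal_smul_snd]
  have h1 := cos_smul_add_sin_smul_le x θ
  have h2 := re_smul_add_im_smul_le y ⟨t * Real.cos θ, t * Real.sin θ⟩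
  have h3 : ‖(⟨t * Real.cos θ, t * Real.sin θ⟩ : ℂ)‖ = |t| := by
    rw [Complex.norm_def, Complex.normSq_mk, ← Real.sqrt_sq_eq_abs]
    congr 1
    linear_combination t ^ 2 * Real.cos_sq_add_sin_sq θ
  rw [h3] at h2
  refine le_of_eq_of_le ?_ (add_le_add h1 h2)
  dsimp only
  module

/-- Disjoint elements satisfy the upper `r`-estimate. -/
theorem norm_rpow_add_le_of_disjoint {r : ℝ} (hr : 1 < r) (hX : IsExactlyConvex r X)
    {x y : Complexification X} (h : x.modulus ⊓ y.modulus = 0) {t : ℝ}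
    (ht : t ∈ Set.Icc (0 : ℝ) 1) :
    ‖x + (t : ℂ) • y‖ ^ r + ‖x - (t : ℂ) • y‖ ^ r ≤ 2 * (‖x‖ ^ r + t ^ r * ‖y‖ ^ r) := by
  have hbound : ∀ s : ℝ, |s| = t → ‖x + (s : ℂ) • y‖ ^ r ≤ ‖x‖ ^ r + t ^ r * ‖y‖ ^ r := by
    intro s hs
    have h1 := modulus_add_smul_le x y s
    rw [hs] at h1
    have h2 := hX.norm_add_rpow_le hr (modulus_nonneg x)
      (smul_nonneg ht.1 (modulus_nonneg y))
      (inf_smul_eq_zero (modulus_nonneg x) (modulus_nonneg y) h ht.1 ht.2)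
    rw [norm_smul, Real.norm_of_nonneg ht.1, Real.mul_rpow ht.1 (norm_nonneg _)] at h2
    refine le_trans ?_ h2
    exact Real.rpow_le_rpow (norm_nonneg (x + (s : ℂ) • y).modulus)
      (norm_le_norm_of_nonneg_of_le (modulus_nonneg _) h1) (by linarith)
  rw [sub_ofReal_smul]
  have h1 := hbound t (abs_of_nonneg ht.1)
  have h2 := hbound (-t) (by rw [abs_neg, abs_of_nonneg ht.1])
  linarith

/-- The inequality `2 ^ (1 / r) (|x|² + |y|²) ^ (1 / 2) ≤ (|x + y| ^ r + |x - y| ^ r) ^ (1 / r)`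
for `r ≥ 2`, tested on the linear minorants of the left side. -/
theorem smul_modulus_add_le_lrSum {r : ℝ} (hr : 2 ≤ r) (x y : Complexification X) {p q : ℝ}
    (hp : 0 ≤ p) (hq : 0 ≤ q) (hpq : p ^ 2 + q ^ 2 ≤ 1) :
    (2 : ℝ) ^ (1 / r) • (p • x.modulus + q • y.modulus) ≤
      lrSum r (x + y).modulus (x - y).modulus := by
  set w := lrSum r (x + y).modulus (x - y).modulus with hw
  -- Normalized so that A^r' = 1/2: two coefficients of mean size A are then admissible in `lrSum`.
  set A : ℝ := (2 : ℝ) ^ (1 / r) / 2 with hA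
  have hApos : 0 < A := by positivity
  have h2A : (2 : ℝ) ^ (1 / r) = 2 * A := by rw [hA]; ring
  have hA1 : A ^ (r / (r - 1)) = 1 / 2 := by
    have h1 : A = (2 : ℝ) ^ (1 / r - 1) := by
      rw [hA, Real.rpow_sub (by norm_num), Real.rpow_one]
    rw [h1, ← Real.rpow_mul (by norm_num)]
    have h2 : (1 / r - 1) * (r / (r - 1)) = -1 := by
      have : r ≠ 0 := by linarith
      have : r - 1 ≠ 0 := by linarith
      field_simp
      ring
    rw [h2, Real.rpow_neg_one]
    norm_num
  have key : ∀ θ φ : ℝ, (2 * A * p) • (Real.cos θ • x.1 + Real.sin θ • x.2) +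
      (2 * A * q) • (Real.cos φ • y.1 + Real.sin φ • y.2) ≤ w := by
    intro θ φ
    -- With a, b = A(p e^(iθ) ± q e^(iφ)), pairing a with x + y and b with x - y recovers the left
    -- side, and the parallelogram law gives |a|² + |b|² = 2A²(p² + q²).
    set a : ℂ := ⟨A * (p * Real.cos θ + q * Real.cos φ), A * (p * Real.sin θ + q * Real.sin φ)⟩
      with ha
    set b : ℂ := ⟨A * (p * Real.cos θ - q * Real.cos φ), A * (p * Real.sin θ - q * Real.sin φ)⟩
      with hb
    have h1 := re_smul_add_im_smul_le (x + y) a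
    have h2 := re_smul_add_im_smul_le (x - y) b
    have hsq : ‖a‖ ^ 2 + ‖b‖ ^ 2 ≤ 2 * A ^ 2 := by
      rw [Complex.sq_norm, Complex.sq_norm, ha, hb, Complex.normSq_mk, Complex.normSq_mk]
      have h3 : A ^ 2 * (p ^ 2 + q ^ 2) ≤ A ^ 2 * 1 :=
        mul_le_mul_of_nonneg_left hpq (sq_nonneg A)
      have h4 := Real.cos_sq_add_sin_sq θ
      have h5 := Real.cos_sq_add_sin_sq φ
      refine le_of_eq_of_le ?_ (mul_le_mul_of_nonneg_left h3 zero_le_two |>.trans_eq (by ring))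
      linear_combination 2 * A ^ 2 * p ^ 2 * h4 + 2 * A ^ 2 * q ^ 2 * h5
    have hr1 : 0 < r - 1 := by linarith
    -- Here r ≥ 2 enters, as r' ≤ 2: the quadratic bound becomes |a|^r' + |b|^r' ≤ 2A^r' = 1.
    have hab := rpow_add_rpow_le_of_sq_add_sq_le (q := r / (r - 1))
      (div_pos (by linarith) hr1) ((div_le_iff₀ hr1).mpr (by linarith))
      (norm_nonneg a) (norm_nonneg b) hApos.le hsq
    rw [hA1] at hab
    have h3 := smul_add_smul_le_lrSum (by linarith : 1 < r) (modulus_nonneg (x + y))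
      (modulus_nonneg (x - y)) (norm_nonneg a) (norm_nonneg b) (hab.trans_eq (by norm_num))
    refine le_of_eq_of_le ?_ ((add_le_add h1 h2).trans h3)
    rw [add_fst, add_snd, sub_fst, sub_snd, ha, hb]
    dsimp only
    module
  -- The angles in `key` are independent, so the suprema over θ and φ can be taken one after the
  -- other.
  have hstep : ∀ (c : ℝ) (z : Complexification X) (m : X), 0 ≤ c →
      (∀ θ : ℝ, c • (Real.cos θ • z.1 + Real.sin θ • z.2) ≤ m) → c • z.modulus ≤ m := by
    intro c z m hc h
    rcases hc.eq_or_lt with rfl | hc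
    · simpa using h 0
    rw [← le_inv_smul_iff_of_pos hc, modulus_le_iff]
    intro θ
    rw [le_inv_smul_iff_of_pos hc]
    exact h θ
  rw [h2A, smul_add, smul_smul, smul_smul, ← le_sub_iff_add_le]
  refine hstep _ _ _ (by positivity) fun θ => ?_
  rw [le_sub_comm]
  refine hstep _ _ _ (by positivity) fun φ => ?_
  rw [le_sub_iff_add_le']
  exact key θ φ

theorem modulus_ofReal_smul (y : Complexification X) {t : ℝ} (ht : 0 < t) :
    ((t : ℂ) • y).modulus = t • y.modulus := by
  refine le_antisymm ?_ ?_
  · have h := modulus_add_smul_le 0 y t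
    have h0 : (0 : Complexification X).modulus ≤ 0 := modulus_le_iff.mpr fun θ => by
      change Real.cos θ • (0 : X) + Real.sin θ • (0 : X) ≤ 0
      simp
    rw [zero_add, abs_of_pos ht] at h
    exact h.trans (by simpa using h0)
  · rw [← le_inv_smul_iff_of_pos ht, modulus_le_iff]
    intro θ
    rw [le_inv_smul_iff_of_pos ht]
    refine le_of_eq_of_le ?_ (cos_smul_add_sin_smul_le _ θ)
    rw [ofReal_smul_fst, ofReal_smul_snd]
    module

/-- The upper `r`-estimate with `r > 2` forces disjointness. -/
theorem disjoint_of_norm_rpow_add_le {r : ℝ} (hr : 2 < r) (hmono : IsStrictlyMonotone X)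
    (hX : IsExactlyConvex r X) {x y : Complexification X}
    (h : ∀ t ∈ Set.Icc (0 : ℝ) 1,
      ‖x + (t : ℂ) • y‖ ^ r + ‖x - (t : ℂ) • y‖ ^ r ≤ 2 * (‖x‖ ^ r + t ^ r * ‖y‖ ^ r)) :
    x.modulus ⊓ y.modulus = 0 := by
  by_contra hne
  set a := x.modulus with ha
  set b := y.modulus with hb
  have ha0 : 0 ≤ a := modulus_nonneg x
  have hb0 : 0 ≤ b := modulus_nonneg y
  have hu0 : 0 ≤ a ⊓ b := le_inf ha0 hb0
  obtain ⟨κ, hκ0, hκ1, hv⟩ := exists_posPart_ne_zero (a := a) hu0 hne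
  -- v is the t² coefficient of the gain over a found in `hlow`, truncated at 0.
  set v := (κ • (a ⊓ b) - κ ^ 2 • a) ⊔ 0 with hvdef
  have hv0 : 0 ≤ v := le_sup_right
  have hva : v ≤ a := by
    refine sup_le ?_ ha0
    have h1 : κ • (a ⊓ b) ≤ a := by
      calc κ • (a ⊓ b) ≤ (1 : ℝ) • (a ⊓ b) := smul_le_smul_of_nonneg_right hκ1 hu0
        _ ≤ a := by rw [one_smul]; exact inf_le_left
    exact (sub_le_self _ (smul_nonneg (sq_nonneg κ) ha0)).trans h1
  have hδ : 0 < ‖a‖ - ‖a - v‖ :=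
    sub_pos.mpr (hmono _ _ (sub_nonneg.mpr hva) (sub_lt_self a (lt_of_le_of_ne hv0 hv.symm)))
  have hapos : 0 < ‖a‖ := by linarith [norm_nonneg (a - v)]
  obtain ⟨t, ht, hlt⟩ := exists_add_mul_sq_rpow_gt (B := ‖b‖) hr hapos hδ
  refine absurd hlt (not_lt.mpr ?_)
  rcases ht.1.eq_or_lt with rfl | ht0
  · simp [Real.zero_rpow (by linarith : r ≠ 0)]
  have htκ : t * κ ≤ 1 := mul_le_one₀ ht.2 hκ0.le hκ1
  have htκ0 : 0 < t * κ := mul_pos ht0 hκ0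
  set w := lrSum r (x + (t : ℂ) • y).modulus (x - (t : ℂ) • y).modulus with hw
  have hmin : ∀ p q : ℝ, 0 ≤ p → 0 ≤ q → p ^ 2 + q ^ 2 ≤ 1 →
      (2 : ℝ) ^ (1 / r) • (p • a + q • t • b) ≤ w := by
    intro p q hp hq hpq
    have := smul_modulus_add_le_lrSum hr.le x ((t : ℂ) • y) hp hq hpq
    rwa [modulus_ofReal_smul y ht0] at this
  have hlow : (2 : ℝ) ^ (1 / r) • (a + t ^ 2 • v) ≤ w := by
    have hcancel : ∀ z : X, (2 : ℝ) ^ (1 / r) • z ≤ w ↔ z ≤ ((2 : ℝ) ^ (1 / r))⁻¹ • w := fun z =>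
      (le_inv_smul_iff_of_pos (by positivity)).symm
    simp only [hcancel] at hmin ⊢
    -- The minorant for the 0 in v = (⋯) ∨ 0; the next choice of p, q handles the other term.
    have h1 := hmin 1 0 zero_le_one le_rfl (by norm_num)
    rw [one_smul, zero_smul, add_zero] at h1
    have hsq : (t * κ) ^ 2 ≤ 1 := pow_le_one₀ htκ0.le htκ
    -- With s = tκ ≤ 1, (1 - s²)² + s² = 1 - s² + s⁴ ≤ 1, and the minorant is a + t²(κb - κ²a): a
    -- gain of order t².
    have h2 := hmin (1 - (t * κ) ^ 2) (t * κ) (by linarith) htκ0.le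
      (by nlinarith [sq_nonneg (t * κ)])
    have h3 : a + t ^ 2 • (κ • (a ⊓ b) - κ ^ 2 • a) ≤ ((2 : ℝ) ^ (1 / r))⁻¹ • w := by
      refine le_trans ?_ h2
      have h4 : (t ^ 2 * κ) • (a ⊓ b) ≤ (t ^ 2 * κ) • b :=
        smul_le_smul_of_nonneg_left inf_le_right (by positivity)
      refine le_of_eq_of_le ?_ ((add_le_add_right h4 ((1 - (t * κ) ^ 2) • a)).trans_eq ?_) <;>
      module
    have ht2 : 0 < t ^ 2 := by positivity
    -- Isolating v lets the two minorants combine by `sup_le`.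
    rw [← le_sub_iff_add_le', ← le_inv_smul_iff_of_pos ht2]
    refine sup_le ?_ ?_
    · rwa [le_inv_smul_iff_of_pos ht2, le_sub_iff_add_le']
    · exact smul_nonneg (by positivity) (sub_nonneg.mpr h1)
  have h2pos : (0 : ℝ) < 2 ^ (1 / r) := by positivity
  have hn1 : 2 ^ (1 / r) * ‖a + t ^ 2 • v‖ ≤ ‖w‖ := by
    have := norm_le_norm_of_nonneg_of_le
      (smul_nonneg h2pos.le (add_nonneg ha0 (smul_nonneg (sq_nonneg t) hv0))) hlow
    rwa [norm_smul, Real.norm_of_nonneg h2pos.le] at this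
  have hn2 : (2 ^ (1 / r) * ‖a + t ^ 2 • v‖) ^ r ≤ ‖w‖ ^ r :=
    Real.rpow_le_rpow (by positivity) hn1 (by linarith)
  rw [Real.mul_rpow h2pos.le (norm_nonneg _), ← Real.rpow_mul zero_le_two, one_div,
    inv_mul_cancel₀ (by linarith), Real.rpow_one] at hn2
  have hn3 := hX.norm_lrSum_rpow_le (by linarith) (x + (t : ℂ) • y).modulus
    (x - (t : ℂ) • y).modulus
  have hn4 := h t ht
  simp only [norm_def] at hn4
  have hn5 : (‖a‖ + t ^ 2 * (‖a‖ - ‖a - v‖)) ^ r ≤ ‖a + t ^ 2 • v‖ ^ r :=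
    Real.rpow_le_rpow (by positivity) (norm_add_mul_le_norm_add_smul a v (sq_nonneg t))
      (by linarith)
  linarith

/-- Angles 0 and π give ±x, and |cos θ| ≤ 1 bounds the rest by |x|. Hence X sits isometrically in
its complexification, preserving moduli. -/
theorem modulus_ofVector (x : X) : (ofVector x).modulus = |x| := by
  refine le_antisymm (modulus_le_iff.mpr fun θ => ?_) (abs_le'.mpr ⟨?_, ?_⟩)
  · change Real.cos θ • x + Real.sin θ • (0 : X) ≤ |x|
    rw [smul_zero, add_zero]
    rcases le_total 0 (Real.cos θ) with h | h
    · calc Real.cos θ • x ≤ Real.cos θ • |x| := smul_le_smul_of_nonneg_left (le_abs_self x) h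
        _ ≤ (1 : ℝ) • |x| := smul_le_smul_of_nonneg_right (Real.cos_le_one θ) (abs_nonneg x)
        _ = |x| := one_smul _ _
    · calc Real.cos θ • x = (-Real.cos θ) • (-x) := by module
        _ ≤ (-Real.cos θ) • |x| := smul_le_smul_of_nonneg_left (neg_le_abs x) (by linarith)
        _ ≤ (1 : ℝ) • |x| :=
          smul_le_smul_of_nonneg_right (by linarith [Real.neg_one_le_cos θ]) (abs_nonneg x)
        _ = |x| := one_smul _ _
  · simpa [ofVector] using cos_smul_add_sin_smul_le (ofVector x) 0
  · simpa [ofVector] using cos_smul_add_sin_smul_le (ofVector x) Real.pi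

theorem norm_ofVector (x : X) : ‖ofVector x‖ = ‖x‖ := by
  rw [norm_def, modulus_ofVector, norm_abs_eq_norm]

end Complexification

/-! ### The criterion for real lattices, by embedding in the complexification -/

section Real

variable {X : Type*} [NormedAddCommGroup X] [Lattice X] [IsOrderedAddMonoid X]
  [HasSolidNorm X] [NormedSpace ℝ X] [IsOrderedModule ℝ X] [CompleteSpace X]

open Complexification

theorem norm_rpow_add_le_of_disjoint {r : ℝ} (hr : 1 < r) (hX : IsExactlyConvex r X)
    {x y : X} (h : |x| ⊓ |y| = 0) {t : ℝ} (ht : t ∈ Set.Icc (0 : ℝ) 1) :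
    ‖x + t • y‖ ^ r + ‖x - t • y‖ ^ r ≤ 2 * (‖x‖ ^ r + t ^ r * ‖y‖ ^ r) := by
  rw [← modulus_ofVector x, ← modulus_ofVector y] at h
  simpa only [ofVector_add_smul, ofVector_sub_smul, norm_ofVector] using
    Complexification.norm_rpow_add_le_of_disjoint hr hX h ht

theorem disjoint_of_norm_rpow_add_le {r : ℝ} (hr : 2 < r) (hmono : IsStrictlyMonotone X)
    (hX : IsExactlyConvex r X) {x y : X}
    (h : ∀ t ∈ Set.Icc (0 : ℝ) 1,
      ‖x + t • y‖ ^ r + ‖x - t • y‖ ^ r ≤ 2 * (‖x‖ ^ r + t ^ r * ‖y‖ ^ r)) :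
    |x| ⊓ |y| = 0 := by
  rw [← modulus_ofVector x, ← modulus_ofVector y]
  refine Complexification.disjoint_of_norm_rpow_add_le hr hmono hX fun t ht => ?_
  simpa only [ofVector_add_smul, ofVector_sub_smul, norm_ofVector] using h t ht

end Real

end BanachLattice

open BanachLattice in
theorem proposition5p2 (r : ℝ) (hr : 2 < r) :
    (∀ (X : Type*) [NormedAddCommGroup X] [Lattice X] [IsOrderedAddMonoid X] [HasSolidNorm X]
      [NormedSpace ℝ X] [IsOrderedModule ℝ X] [CompleteSpace X],
      IsStrictlyMonotone X → IsExactlyConvex r X →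
        (∀ x y : X, |x| ⊓ |y| = 0 ↔
          ∀ t ∈ Set.Icc (0 : ℝ) 1,
            ‖x + t • y‖ ^ r + ‖x - t • y‖ ^ r ≤ 2 * (‖x‖ ^ r + t ^ r * ‖y‖ ^ r)) ∧
        (∀ x y : Complexification X, x.modulus ⊓ y.modulus = 0 ↔
          ∀ t ∈ Set.Icc (0 : ℝ) 1,
            ‖x + (t : ℂ) • y‖ ^ r + ‖x - (t : ℂ) • y‖ ^ r ≤ 2 * (‖x‖ ^ r + t ^ r * ‖y‖ ^ r))) ∧
    (∀ (X : Type*) [NormedAddCommGroup X] [Lattice X] [IsOrderedAddMonoid X] [HasSolidNorm X]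
      [NormedSpace ℝ X] [IsOrderedModule ℝ X] [CompleteSpace X]
      (Y : Type*) [NormedAddCommGroup Y] [Lattice Y] [IsOrderedAddMonoid Y] [HasSolidNorm Y]
      [NormedSpace ℝ Y] [IsOrderedModule ℝ Y] [CompleteSpace Y],
      IsExactlyConvex r X → IsExactlyConvex r Y → IsStrictlyMonotone Y →
        (∀ T : X →ₗᵢ[ℝ] Y, ∀ x y : X, |x| ⊓ |y| = 0 → |T x| ⊓ |T y| = 0) ∧
        (∀ T : Complexification X →ₗ[ℂ] Complexification Y, (∀ z, ‖T z‖ = ‖z‖) →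
          ∀ x y : Complexification X, x.modulus ⊓ y.modulus = 0 →
            (T x).modulus ⊓ (T y).modulus = 0)) := by
  refine ⟨fun X => ?_, fun X _ _ _ _ _ _ _ Y => ?_⟩
  · intro _ _ _ _ _ _ _ hmono hX
    refine ⟨fun x y => ⟨fun h t ht => ?_, fun h => ?_⟩, fun x y =>
      ⟨fun h t ht => Complexification.norm_rpow_add_le_of_disjoint (by linarith) hX h ht,
        Complexification.disjoint_of_norm_rpow_add_le hr hmono hX⟩⟩
    · exact norm_rpow_add_le_of_disjoint (by linarith) hX h ht
    · exact disjoint_of_norm_rpow_add_le hr hmono hX h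
  · intro _ _ _ _ _ _ _ hX hY hmono
    -- The estimate holds in X by disjointness, T preserves every norm in it, and its converse is
    -- applied in Y, where the norm is strictly monotone.
    refine ⟨fun T x y h => disjoint_of_norm_rpow_add_le hr hmono hY fun t ht => ?_,
      fun T hT x y h => Complexification.disjoint_of_norm_rpow_add_le hr hmono hY fun t ht => ?_⟩
    · rw [← T.map_smul, ← T.map_add, ← T.map_sub]
      simp only [T.norm_map]
      exact norm_rpow_add_le_of_disjoint (by linarith) hX h ht
    · rw [← T.map_smul, ← T.map_add, ← T.map_sub]
      simp only [hT]
      exact Complexification.norm_rpow_add_le_of_disjoint (by linarith) hX h ht
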